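/- Let $d\ge 2$ and, for $N\ge 3$, let $T^d_N$ be the $d$-dimensional torus graph: its vertex set is $(\mathbb{Z}/N\mathbb{Z})^d$, and two vertices are adjacent if and only if they agree in $d-1$ coordinates and differ by $\pm1$ modulo $N$ in the remaining one (so $T^d_N$ is $2d$-regular with $N^d$ vertices). For a graph $G$, replace each edge $uv$ by the two arcs $(u,v)$ and $(v,u)$. An alternating walk of length $r$ is a sequence of vertices $v_0,\dots,v_r$ with arcs $e_1,\dots,e_r$ such that either $e_i=(v_{i-1},v_i)$ for odd $i$ and $e_i=(v_i,v_{i-1})$ for even $i$, or $e_i=(v_i,v_{i-1})$ for odd $i$ and $e_i=(v_{i-1},v_i)$ for even $i$. For $r \geq 1$ it is an $x_0$-alternating cycle if $v_0=v_r=x_0$ and either $e_1,e_r$ both originate at $x_0$ or both terminate at $x_0$; it is reduced if $e_{i+1}\ne e_i$ for $1\le i\le r-1$ and $e_r\neq e_1$. Let $N^0_k$ be the number of reduced $x_0$-alternating cycles of length $k$ in $G$. The generalized alternating zeta function of $G$ with base vertex $x_0$ is $$\zeta_a(G,t)=\exp\Big(\sum_{k=1}^\infty \frac{N^0_k}{k}\,t^k\Big).$$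 Let $t\in\mathbb{C}$ with $|t|<\frac1{2d-1}$, and let a base vertex of $T^d_N$ be chosen arbitrarily for each $N$. Then the series defining $\zeta_a(T^d_N,t)$ converges absolutely for every $N\ge 3$; for all real $\theta_1,\dots,\theta_d$ the number $(1+(2d-1)t^2)^2-4t^2\big(\sum_{j=1}^d\cos\theta_j\big)^2$ lies in $\mathbb{C}\setminus(-\infty,0]$; its principal logarithm is integrable over $[0,2\pi)^d$; and $$\lim_{N\to\infty}\zeta_a(T^d_N,t)^{-1}=(1-t^2)^{2(d-1)}\exp\left[\int_{[0,2\pi)^d}\log\Big\{(1+(2d-1)t^2)^2-4t^2\Big(\sum_{j=1}^d\cos\theta_j\Big)^2\Big\}\frac{d\theta_1}{2\pi}\cdots\frac{d\theta_d}{2\pi}\right].$$ -/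

import Mathlib

/-- The symmetric digraph of a graph: every edge `uv` gives the two arcs `(u, v)` and `(v, u)`. -/
def SimpleGraph.symmDigraph {V : Type*} (G : SimpleGraph V) : Digraph V where
  Adj := G.Adj

/-- An alternating walk `(v₀, …, v_r) = [e₁, …, e_r]` of length `r` in a digraph. The arc `(u, v)`,
with origin `u` and terminus `v`, is the pair `(u, v)`; the arcs are numbered from `0`, so that
`arc i` joins `vert i` and `vert (i + 1)`. Consecutive arcs have opposite directions along the walk:
the walk starts with an out-edge (first alternative) or with an in-edge (second alternative). -/
@[ext]
structure AlternatingWalk {V : Type*} (D : Digraph V) (r : ℕ) where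
  vert : Fin (r + 1) → V
  arc : Fin r → V × V
  adj : ∀ i, D.Adj (arc i).1 (arc i).2
  alternating :
    (∀ i : Fin r, arc i =
      if Even (i : ℕ) then (vert i.castSucc, vert i.succ) else (vert i.succ, vert i.castSucc)) ∨
    (∀ i : Fin r, arc i =
      if Even (i : ℕ) then (vert i.succ, vert i.castSucc) else (vert i.castSucc, vert i.succ))

namespace AlternatingWalk

variable {V : Type*} {D : Digraph V} {r : ℕ}

/-- `P` is an `x`-alternating cycle: it starts and ends at `x`, and its first and last arcs both
originate at `x` or both terminate at `x`. -/
def IsCycleAt (P : AlternatingWalk D r) (x : V) : Prop :=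
  P.vert 0 = x ∧ P.vert (Fin.last r) = x ∧
    ∃ h : 0 < r,
      ((P.arc ⟨0, h⟩).1 = x ∧ (P.arc ⟨r - 1, by omega⟩).1 = x) ∨
      ((P.arc ⟨0, h⟩).2 = x ∧ (P.arc ⟨r - 1, by omega⟩).2 = x)

/-- Two consecutive arcs coincide. -/
def HasBacktracking (P : AlternatingWalk D r) : Prop :=
  ∃ i j : Fin r, (j : ℕ) = i + 1 ∧ P.arc j = P.arc i

/-- The last arc coincides with the first one. -/
def HasTail (P : AlternatingWalk D r) : Prop :=
  ∃ h : 0 < r, P.arc ⟨r - 1, by omega⟩ = P.arc ⟨0, h⟩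

/-- Neither a backtracking nor a tail. -/
def IsReduced (P : AlternatingWalk D r) : Prop :=
  ¬ P.HasBacktracking ∧ ¬ P.HasTail

end AlternatingWalk

/-- The number of reduced `x`-alternating cycles of length `k` in (the symmetric digraph of) `G`. -/
noncomputable def numReducedAltCycles {V : Type*} (G : SimpleGraph V) (x : V) (k : ℕ) : ℕ :=
  Nat.card {P : AlternatingWalk G.symmDigraph k // P.IsCycleAt x ∧ P.IsReduced}

/-- The `k`-th term, `k ≥ 1` being written as `n + 1`, of the series `∑_{k ≥ 1} (N⁰_k / k) t ^ k`. -/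
noncomputable def altZetaTerm {V : Type*} (G : SimpleGraph V) (x : V) (t : ℂ) (n : ℕ) : ℂ :=
  (numReducedAltCycles G x (n + 1) : ℂ) / ((n + 1 : ℕ) : ℂ) * t ^ (n + 1)

/-- The generalized alternating zeta function of `G` with base vertex `x`. -/
noncomputable def generalizedAltZeta {V : Type*} (G : SimpleGraph V) (x : V) (t : ℂ) : ℂ :=
  Complex.exp (∑' n : ℕ, altZetaTerm G x t n)

/-- The `d`-dimensional torus graph with `N ^ d` vertices (`N ≥ 1`): two distinct vertices are
adjacent when they agree in all but one coordinate, where they differ by `1` modulo `N`. -/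
def torusGraph (d N : ℕ) : SimpleGraph (Fin d → ZMod N) where
  Adj v w := v ≠ w ∧ ∃ k, (∀ j, j ≠ k → v j = w j) ∧ (w k = v k + 1 ∨ v k = w k + 1)
  symm := ⟨fun _ _ ⟨hne, k, hk, h⟩ => ⟨hne.symm, k, fun j hj => (hk j hj).symm, h.symm⟩⟩
  loopless := ⟨fun _ h => h.1 rfl⟩

/-- The cube `[0, 2π) ^ d`. -/
def angleCube (d : ℕ) : Set (Fin d → ℝ) :=
  Set.univ.pi fun _ => Set.Ico 0 (2 * Real.pi)

/-- The function `log {(1 + (2d - 1) t²)² - 4 t² (∑ⱼ cos θⱼ)²}` (principal branch). -/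
noncomputable def torusLogIntegrand (d : ℕ) (t : ℂ) (θ : Fin d → ℝ) : ℂ :=
  Complex.log ((1 + (2 * (d : ℂ) - 1) * t ^ 2) ^ 2 - 4 * t ^ 2 * (∑ j, (Real.cos (θ j) : ℂ)) ^ 2)

/-! An alternating cycle is a closed walk with a choice of direction for its first arc. Parity rules
out odd lengths, and in even length `k` there are twice as many reduced alternating cycles as closed
walks without backtracking or tail. In the torus with `N ≥ 3` these walks are the cyclically reduced
words in the `2d` letters `± e_j` whose displacement vanishes modulo `N`. Once `N > k` this means
displacement zero in `ℤ ^ d`, so every coefficient of the series is eventually constant in `N`.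

By Fourier inversion the limiting coefficient is the mean over `θ` of `cyclicWordSum`, the trace of
the `k`-th power of a non-backtracking matrix weighted by a character. Its spectrum is explicit
(`trace_nonBacktrackingMatrix_pow`): the roots `p`, `p'` of `X ^ 2 - 2 (∑ cos θ_j) X + (2d - 1)`,
and `1` and `-1`, each `d - 1` times. Summing the even part of the logarithmic series over this
spectrum gives `(1 - (p t) ^ 2) (1 - (p' t) ^ 2)`, which is the braced expression, and the power of
`1 - t ^ 2` (`hasSum_cyclicWordSum`).

Since `‖p‖, ‖p'‖ ≤ 2d - 1`, the terms are dominated by a geometric series of ratio `(2d - 1) ‖t‖ <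
1`, uniformly in `N`, `x` and `θ`. This justifies both exchanges of limits and keeps all the
logarithms away from the branch cut. -/

/-! ### The non-backtracking transfer matrix -/

/-- The transfer matrix of non-backtracking words in the alphabet `ι` with formal inverse `rev`,
where the letter `s` carries the weight `χ s`. -/
def nonBacktrackingMatrix {ι R : Type*} [DecidableEq ι] [CommRing R] (rev : ι → ι) (χ : ι → R) :
    Matrix ι ι R :=
  Matrix.of fun s s' => if s' = rev s then 0 else χ s

section TransferMatrix

open Matrix

variable {ι R : Type*} [Fintype ι] [DecidableEq ι] [CommRing R] {rev : ι → ι} {χ : ι → R}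

lemma nonBacktrackingMatrix_mulVec (v : ι → R) :
    nonBacktrackingMatrix rev χ *ᵥ v = fun s => χ s * (∑ s', v s' - v (rev s)) := by
  ext s
  have h : ∀ s', nonBacktrackingMatrix rev χ s s' * v s'
      = χ s * v s' - (if s' = rev s then χ s * v s' else 0) := by
    intro s'
    by_cases h : s' = rev s <;> simp [nonBacktrackingMatrix, h]
  simp only [mulVec, dotProduct, h, Finset.sum_sub_distrib, Finset.sum_ite_eq', Finset.mem_univ,
    if_true, mul_sub, Finset.mul_sum]

/-- Write `B = χ 1ᵀ - D P`, with `D` the diagonal of `χ` and `P` the permutation `rev`. Then `(D P)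
^ 2 = 1`, so `B ^ 2 - 1` has all its columns in the span of `χ` and `1`. -/
lemma nonBacktrackingMatrix_sq (hrev : Function.Involutive rev) (hχ : ∀ s, χ s * χ (rev s) = 1) :
    nonBacktrackingMatrix rev χ * nonBacktrackingMatrix rev χ =
      (∑ s, χ s) • vecMulVec χ 1 - vecMulVec χ (χ ∘ rev) - vecMulVec 1 1 + 1 := by
  ext s s'
  have h := congrFun (nonBacktrackingMatrix_mulVec (rev := rev) (χ := χ)
    (fun b => nonBacktrackingMatrix rev χ b s')) s
  have h1 : ∑ b, nonBacktrackingMatrix rev χ b s' = ∑ b, χ b - χ (rev s') := by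
    have : ∀ b, nonBacktrackingMatrix rev χ b s' = χ b - if b = rev s' then χ b else 0 := by
      intro b
      have : s' = rev b ↔ b = rev s' := by
        constructor <;> (rintro rfl; rw [hrev])
      simp only [nonBacktrackingMatrix, of_apply, this]
      split_ifs <;> simp
    simp [this, Finset.sum_sub_distrib]
  have h2 : χ s * nonBacktrackingMatrix rev χ (rev s) s' = 1 - (1 : Matrix ι ι R) s s' := by
    simp only [nonBacktrackingMatrix, of_apply, hrev s, one_apply, eq_comm (a := s')]
    split_ifs <;> simp [hχ]
  change (nonBacktrackingMatrix rev χ *ᵥ _) s = _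
  rw [h, h1, mul_sub, h2]
  simp [vecMulVec_apply]
  ring

lemma nonBacktrackingMatrix_mulVec_one :
    nonBacktrackingMatrix rev χ *ᵥ 1 = ((Fintype.card ι : R) - 1) • χ := by
  rw [nonBacktrackingMatrix_mulVec]
  ext s
  simp [mul_comm]

lemma nonBacktrackingMatrix_mulVec_weight (hχ : ∀ s, χ s * χ (rev s) = 1) :
    nonBacktrackingMatrix rev χ *ᵥ χ = (∑ s, χ s) • χ - 1 := by
  rw [nonBacktrackingMatrix_mulVec]
  ext s
  simp [mul_sub, hχ, mul_comm]

/-- The span of `χ` and `1` is stable under `B`, which satisfies `X ^ 2 - l X + (card ι - 1)` there.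
As `B ^ 2 - 1` maps into this span, `(B ^ 2 - l B + (card ι - 1)) (B ^ 2 - 1) = 0`. -/
lemma nonBacktrackingMatrix_annihilated (hrev : Function.Involutive rev)
    (hχ : ∀ s, χ s * χ (rev s) = 1) :
    nonBacktrackingMatrix rev χ ^ 4 =
      (∑ s, χ s) • nonBacktrackingMatrix rev χ ^ 3
        + (2 - (Fintype.card ι : R)) • nonBacktrackingMatrix rev χ ^ 2
        - (∑ s, χ s) • nonBacktrackingMatrix rev χ + ((Fintype.card ι : R) - 1) • 1 := by
  set B := nonBacktrackingMatrix rev χ with hB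
  set l := ∑ s, χ s
  set X := l • vecMulVec χ 1 - vecMulVec χ (χ ∘ rev) - vecMulVec 1 1 with hX
  have hBB : B * B = X + 1 := nonBacktrackingMatrix_sq hrev hχ
  have hone : B *ᵥ 1 = ((Fintype.card ι : R) - 1) • χ := nonBacktrackingMatrix_mulVec_one
  have hu : B *ᵥ χ = l • χ - 1 := nonBacktrackingMatrix_mulVec_weight hχ
  have hBX : B * (B * X) = l • (B * X) - ((Fintype.card ι : R) - 1) • X := by
    simp only [hX, mul_sub, mul_smul_comm, mul_vecMulVec, hone, hu,
      sub_vecMulVec, smul_vecMulVec, smul_sub]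
    module
  have h3 : B ^ 3 = B * X + B := by rw [pow_succ', pow_two, hBB, mul_add, mul_one]
  have h4 : B ^ 4 = B * (B * X) + B * B := by rw [pow_succ', h3, mul_add]
  rw [h4, h3, pow_two, hBX, hBB]
  module

lemma trace_nonBacktrackingMatrix (hfix : ∀ s, rev s ≠ s) :
    trace (nonBacktrackingMatrix rev χ) = ∑ s, χ s := by
  simp only [trace, diag, nonBacktrackingMatrix, of_apply]
  exact Finset.sum_congr rfl fun s _ => if_neg (hfix s).symm

lemma trace_nonBacktrackingMatrix_sq (hrev : Function.Involutive rev)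
    (hχ : ∀ s, χ s * χ (rev s) = 1) :
    trace (nonBacktrackingMatrix rev χ ^ 2) = (∑ s, χ s) ^ 2 - Fintype.card ι := by
  rw [pow_two, nonBacktrackingMatrix_sq hrev hχ]
  simp only [trace_add, trace_sub, trace_smul, trace_vecMulVec, trace_one]
  simp [dotProduct, hχ]
  ring

lemma trace_nonBacktrackingMatrix_cube (hrev : Function.Involutive rev) (hfix : ∀ s, rev s ≠ s)
    (hχ : ∀ s, χ s * χ (rev s) = 1) :
    trace (nonBacktrackingMatrix rev χ ^ 3) =
      (∑ s, χ s) ^ 3 - 3 * ((Fintype.card ι : R) - 1) * ∑ s, χ s := by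
  have hsum : ∑ s, χ (rev s) = ∑ s, χ s := Equiv.sum_comp hrev.toPerm χ
  rw [pow_succ', pow_two, nonBacktrackingMatrix_sq hrev hχ]
  simp only [mul_add, mul_sub, mul_one, mul_smul_comm, mul_vecMulVec,
    nonBacktrackingMatrix_mulVec_weight hχ, nonBacktrackingMatrix_mulVec_one, trace_add, trace_sub,
    trace_smul, trace_vecMulVec, trace_nonBacktrackingMatrix hfix]
  simp [dotProduct, sub_mul, mul_assoc, hχ, ← Finset.mul_sum, hsum]
  ring

/-- The trace of a power of the transfer matrix, in terms of the roots `p`, `p'` of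
`X ^ 2 - (∑ s, χ s) X + (2 d - 1)`, where `2 d` is the number of letters. -/
lemma trace_nonBacktrackingMatrix_pow (hrev : Function.Involutive rev) (hfix : ∀ s, rev s ≠ s)
    (hχ : ∀ s, χ s * χ (rev s) = 1) {d : ℕ} (hd : Fintype.card ι = 2 * d) {p p' : R}
    (hsum : p + p' = ∑ s, χ s) (hprod : p * p' = 2 * d - 1) (n : ℕ) :
    trace (nonBacktrackingMatrix rev χ ^ n) = p ^ n + p' ^ n + (d - 1) * (1 + (-1) ^ n) := by
  have hcard : (Fintype.card ι : R) = 2 * d := by rw [hd]; push_cast; ring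
  -- Both sides satisfy the linear recurrence of order four given by the annihilating polynomial,
  -- whose roots are `p`, `p'`, `1`, `-1`; agreement for `n ≤ 3` fixes the multiplicities.
  induction n using Nat.strong_induction_on with
  | _ n ih =>
    match n with
    | 0 => simp [hcard]; ring
    | 1 => rw [pow_one, trace_nonBacktrackingMatrix hfix, ← hsum]; ring
    | 2 =>
      rw [trace_nonBacktrackingMatrix_sq hrev hχ, ← hsum, hcard]
      linear_combination 2 * hprod
    | 3 =>
      rw [trace_nonBacktrackingMatrix_cube hrev hfix hχ, ← hsum, hcard]
      linear_combination 3 * (p + p') * hprod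
    | m + 4 =>
      rw [pow_add, nonBacktrackingMatrix_annihilated hrev hχ]
      simp only [mul_add, mul_sub, mul_smul_comm, ← pow_add, ← pow_succ, mul_one, trace_add,
        trace_sub, trace_smul, smul_eq_mul]
      rw [ih (m + 3) (by omega), ih (m + 2) (by omega), ih (m + 1) (by omega), ih m (by omega),
        ← hsum, hcard]
      simp only [pow_add]
      linear_combination (p ^ m * (p ^ 2 - 1) + p' ^ m * (p' ^ 2 - 1)) * hprod

/-- The entries of a matrix power as sums over paths. -/
lemma matrix_pow_apply_eq_sum_paths (B : Matrix ι ι R) (n : ℕ) (a b : ι) :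
    (B ^ n) a b = ∑ w : Fin (n + 1) → ι,
      if w 0 = a ∧ w (Fin.last n) = b then ∏ i : Fin n, B (w i.castSucc) (w i.succ) else 0 := by
  induction n generalizing a with
  | zero =>
    rw [← (Equiv.funUnique (Fin 1) ι).symm.sum_comp]
    simp only [pow_zero, one_apply, Fin.last_zero, Finset.univ_eq_empty, Finset.prod_empty,
      Equiv.funUnique_symm_apply, uniqueElim_const]
    rw [Finset.sum_eq_single a]
    · simp
    · intro c _ hc; simp [hc]
    · simp
  | succ n ih =>
    rw [pow_succ', mul_apply]
    symm
    rw [← (Fin.consEquiv fun _ => ι).sum_comp, Fintype.sum_prod_type, Finset.sum_eq_single a]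
    · simp only [ih, Finset.mul_sum, mul_ite, mul_zero]
      rw [Finset.sum_comm]
      refine Finset.sum_congr rfl fun w _ => ?_
      symm
      rw [Finset.sum_eq_single (w 0)]
      · simp [Fin.consEquiv, Fin.prod_univ_succ, ← Fin.succ_last]
      · intro c _ hc; simp [hc.symm]
      · simp
    · intro c _ hc
      simp [Fin.consEquiv, hc]
    · simp

end TransferMatrix

/-! ### Reduced alternating cycles and reduced closed walks -/

/-- A closed walk at `x` of length `n + 1`, given by its vertices, without backtracking and without
tail. -/
def IsReducedClosedWalk {V : Type*} (G : SimpleGraph V) (x : V) {n : ℕ} (v : Fin (n + 2) → V) :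
    Prop :=
  v 0 = x ∧ v (Fin.last (n + 1)) = x ∧ (∀ i : Fin (n + 1), G.Adj (v i.castSucc) (v i.succ)) ∧
    (∀ i j : Fin (n + 1), (j : ℕ) = i + 1 → v j.succ ≠ v i.castSucc) ∧
    v (Fin.last n).castSucc ≠ v 1

section AlternatingCycles

variable {V : Type*} {G : SimpleGraph V} {x : V} {n : ℕ}

/-- The arcs along the vertex sequence `v`, with alternating directions; the first arc is an
out-edge when `b` is true and an in-edge otherwise. -/
def alternatingArc (b : Bool) (v : Fin (n + 2) → V) (i : Fin (n + 1)) : V × V :=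
  if (Even (i : ℕ) ↔ b = true) then (v i.castSucc, v i.succ) else (v i.succ, v i.castSucc)

lemma alternatingArc_adj {b : Bool} {v : Fin (n + 2) → V}
    (hv : ∀ i : Fin (n + 1), G.Adj (v i.castSucc) (v i.succ)) (i : Fin (n + 1)) :
    G.Adj (alternatingArc b v i).1 (alternatingArc b v i).2 := by
  unfold alternatingArc
  split_ifs
  exacts [hv i, (hv i).symm]

/-- Consecutive arcs point in opposite directions along the walk, so equality of arcs is exactly a
step back over the same edge. -/
lemma alternatingArc_eq_iff_of_succ {b : Bool} {v : Fin (n + 2) → V} {i j : Fin (n + 1)}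
    (hij : (j : ℕ) = i + 1) :
    alternatingArc b v j = alternatingArc b v i ↔ v j.succ = v i.castSucc := by
  have hv : v j.castSucc = v i.succ := congrArg v (Fin.ext (by simp [hij]))
  have hpar : Even (j : ℕ) ↔ ¬ Even (i : ℕ) := by rw [hij, Nat.even_add_one]
  cases b <;> by_cases h : Even (i : ℕ) <;> simp [alternatingArc, hpar, hv, h]

/-- The alternating walk along a walk of the graph. -/
def alternatingWalkOf (b : Bool) (v : Fin (n + 2) → V)
    (hv : ∀ i : Fin (n + 1), G.Adj (v i.castSucc) (v i.succ)) :
    AlternatingWalk G.symmDigraph (n + 1) where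
  vert := v
  arc := alternatingArc b v
  adj := alternatingArc_adj hv
  alternating := by
    cases b
    · right
      intro i
      by_cases h : Even (i : ℕ) <;> simp [alternatingArc, h]
    · left
      intro i
      by_cases h : Even (i : ℕ) <;> simp [alternatingArc, h]

lemma exists_alternatingWalkOf_eq (P : AlternatingWalk G.symmDigraph (n + 1)) :
    ∃ (b : Bool) (hv : ∀ i : Fin (n + 1), G.Adj (P.vert i.castSucc) (P.vert i.succ)),
      alternatingWalkOf b P.vert hv = P := by
  have key : ∃ b : Bool, P.arc = alternatingArc b P.vert := by
    rcases P.alternating with h | h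
    · refine ⟨true, funext fun i => ?_⟩
      rw [h i]
      by_cases h : Even (i : ℕ) <;> simp [alternatingArc, h]
    · refine ⟨false, funext fun i => ?_⟩
      rw [h i]
      by_cases h : Even (i : ℕ) <;> simp [alternatingArc, h]
  obtain ⟨b, hb⟩ := key
  refine ⟨b, fun i => ?_, ?_⟩
  · have h : G.Adj (P.arc i).1 (P.arc i).2 := P.adj i
    rw [hb] at h
    unfold alternatingArc at h
    split_ifs at h
    exacts [h, h.symm]
  · exact AlternatingWalk.ext rfl hb.symm

lemma alternatingArc_zero (b : Bool) (v : Fin (n + 2) → V) :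
    alternatingArc b v 0 = if b then (v 0, v 1) else (v 1, v 0) := by
  cases b <;> simp [alternatingArc]

lemma alternatingArc_last (hn : Odd n) (b : Bool) (v : Fin (n + 2) → V) :
    alternatingArc b v (Fin.last n) =
      if b then (v (Fin.last (n + 1)), v (Fin.last n).castSucc)
      else (v (Fin.last n).castSucc, v (Fin.last (n + 1))) := by
  have : ¬ Even n := Nat.not_even_iff_odd.2 hn
  cases b <;> simp [alternatingArc, this]

/-- The length `n + 1` is odd, so the first and last arcs have the same direction along the walk.
Both originating, or both terminating, at `x` would then force a loop. -/
lemma not_isCycleAt_of_even (hn : Even n) (P : AlternatingWalk G.symmDigraph (n + 1)) :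
    ¬ P.IsCycleAt x := by
  obtain ⟨b, hv, hP⟩ := exists_alternatingWalkOf_eq P
  rintro ⟨h0, hl, _, h⟩
  have hne0 : P.vert 0 ≠ P.vert 1 := by simpa using (hv 0).ne
  have hnel : P.vert (Fin.last n).castSucc ≠ P.vert (Fin.last (n + 1)) := by
    simpa using (hv (Fin.last n)).ne
  have ha0 : P.arc 0 = if b then (P.vert 0, P.vert 1) else (P.vert 1, P.vert 0) := by
    rw [← alternatingArc_zero]; rw [← hP]; rfl
  have hal : P.arc (Fin.last n) =
      if b then (P.vert (Fin.last n).castSucc, P.vert (Fin.last (n + 1)))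
      else (P.vert (Fin.last (n + 1)), P.vert (Fin.last n).castSucc) := by
    have : P.arc (Fin.last n) = alternatingArc b P.vert (Fin.last n) := by rw [← hP]; rfl
    rw [this]
    cases b <;> simp [alternatingArc, hn]
  change ((P.arc 0).1 = x ∧ (P.arc (Fin.last n)).1 = x) ∨
    ((P.arc 0).2 = x ∧ (P.arc (Fin.last n)).2 = x) at h
  rw [ha0, hal] at h
  cases b <;> simp only [if_true, Bool.false_eq_true, if_false] at h <;>
    rcases h with ⟨h, h'⟩ | ⟨h, h'⟩
  · exact hne0 (h0.trans h.symm)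
  · exact hnel (h'.trans hl.symm)
  · exact hnel (h'.trans hl.symm)
  · exact hne0 (h0.trans h.symm)

/-- In even length the first and last arcs have opposite directions along the walk: the condition on
arcs at `x` is automatic for a closed walk, and a tail means that the walk returns along its first
edge. -/
lemma alternatingWalkOf_isCycleAt_and_isReduced_iff (hn : Odd n) (b : Bool) (v : Fin (n + 2) → V)
    (hv : ∀ i : Fin (n + 1), G.Adj (v i.castSucc) (v i.succ)) :
    (alternatingWalkOf b v hv).IsCycleAt x ∧ (alternatingWalkOf b v hv).IsReduced ↔
      IsReducedClosedWalk G x v := by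
  have hcyc : (alternatingWalkOf b v hv).IsCycleAt x ↔ v 0 = x ∧ v (Fin.last (n + 1)) = x := by
    refine ⟨fun h => ⟨h.1, h.2.1⟩, fun h => ⟨h.1, h.2, Nat.succ_pos n, ?_⟩⟩
    change ((alternatingArc b v 0).1 = x ∧ (alternatingArc b v (Fin.last n)).1 = x) ∨
      ((alternatingArc b v 0).2 = x ∧ (alternatingArc b v (Fin.last n)).2 = x)
    rw [alternatingArc_zero, alternatingArc_last hn]
    cases b <;> simp [h.1, h.2]
  have hback : (alternatingWalkOf b v hv).HasBacktracking ↔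
      ∃ i j : Fin (n + 1), (j : ℕ) = i + 1 ∧ v j.succ = v i.castSucc :=
    exists_congr fun i => exists_congr fun j =>
      and_congr_right fun hij => alternatingArc_eq_iff_of_succ hij
  have htail : v 0 = x → v (Fin.last (n + 1)) = x →
      ((alternatingWalkOf b v hv).HasTail ↔ v (Fin.last n).castSucc = v 1) := by
    intro h0 hl
    have : (alternatingWalkOf b v hv).HasTail ↔
        alternatingArc b v (Fin.last n) = alternatingArc b v 0 :=
      ⟨fun h => h.2, fun h => ⟨Nat.succ_pos n, h⟩⟩
    rw [this, alternatingArc_zero, alternatingArc_last hn]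
    cases b <;> simp [h0, hl]
  unfold AlternatingWalk.IsReduced IsReducedClosedWalk
  rw [hcyc, hback]
  push Not
  constructor
  · rintro ⟨⟨h0, hl⟩, h1, h2⟩
    exact ⟨h0, hl, hv, h1, fun h => h2 ((htail h0 hl).2 h)⟩
  · rintro ⟨h0, hl, -, h1, h2⟩
    exact ⟨⟨h0, hl⟩, h1, fun h => h2 ((htail h0 hl).1 h)⟩

lemma numReducedAltCycles_of_odd_length (hn : Even n) : numReducedAltCycles G x (n + 1) = 0 := by
  have : IsEmpty {P : AlternatingWalk G.symmDigraph (n + 1) // P.IsCycleAt x ∧ P.IsReduced} :=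
    ⟨fun P => not_isCycleAt_of_even hn P.1 P.2.1⟩
  exact Nat.card_of_isEmpty

lemma numReducedAltCycles_of_even_length (hn : Odd n) :
    numReducedAltCycles G x (n + 1) =
      2 * Nat.card {v : Fin (n + 2) → V // IsReducedClosedWalk G x v} := by
  let f : Bool × {v : Fin (n + 2) → V // IsReducedClosedWalk G x v} →
      {P : AlternatingWalk G.symmDigraph (n + 1) // P.IsCycleAt x ∧ P.IsReduced} := fun p =>
    ⟨alternatingWalkOf p.1 p.2.1 p.2.2.2.2.1,
      (alternatingWalkOf_isCycleAt_and_isReduced_iff hn _ _ _).2 p.2.2⟩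
  have hf : Function.Bijective f := by
    constructor
    · rintro ⟨b, v, hv⟩ ⟨b', v', hv'⟩ h
      have h := congrArg Subtype.val h
      obtain rfl : v = v' := congrArg AlternatingWalk.vert h
      have h0 : alternatingArc b v 0 = alternatingArc b' v 0 :=
        congrFun (congrArg AlternatingWalk.arc h) 0
      have hne : v 0 ≠ v 1 := by simpa using (hv.2.2.1 0).ne
      rw [alternatingArc_zero, alternatingArc_zero] at h0
      cases b <;> cases b' <;> simp [hne, hne.symm] at h0 ⊢
    · rintro ⟨P, hP⟩
      obtain ⟨b, hv, hb⟩ := exists_alternatingWalkOf_eq P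
      refine ⟨⟨b, P.vert, ?_⟩, Subtype.ext hb⟩
      rw [← hb] at hP
      exact (alternatingWalkOf_isCycleAt_and_isReduced_iff hn _ _ _).1 hP
  rw [numReducedAltCycles, ← Nat.card_congr (Equiv.ofBijective f hf), Nat.card_prod]
  simp

end AlternatingCycles

/-! ### Words in the steps of the torus -/

/-- The lattice vector `± e_j` of a letter. -/
def letterStep {d : ℕ} (s : Fin d × Bool) : Fin d → ℤ := Pi.single s.1 (if s.2 then 1 else -1)

/-- The letter with the opposite step. -/
def letterRev {d : ℕ} (s : Fin d × Bool) : Fin d × Bool := (s.1, !s.2)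

/-- The total displacement of the first `k` letters of a word. -/
def displacement {d k : ℕ} (w : Fin (k + 1) → Fin d × Bool) : Fin d → ℤ :=
  ∑ i : Fin k, letterStep (w i.castSucc)

/-- The cyclically reduced words of length `k`, closed up by repeating the first letter. -/
def cyclicWords (d k : ℕ) : Finset (Fin (k + 1) → Fin d × Bool) :=
  {w | w (Fin.last k) = w 0 ∧ ∀ i : Fin k, w i.succ ≠ letterRev (w i.castSucc)}

section TorusWords

variable {d N n k : ℕ}

lemma letterRev_involutive : Function.Involutive (letterRev (d := d)) := by
  rintro ⟨j, b⟩
  simp [letterRev]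

lemma letterRev_ne (s : Fin d × Bool) : letterRev s ≠ s := by
  obtain ⟨j, b⟩ := s
  simp [letterRev]

lemma letterStep_letterRev (s : Fin d × Bool) : letterStep (letterRev s) = -letterStep s := by
  obtain ⟨j, b⟩ := s
  cases b <;> simp [letterStep, letterRev, ← Pi.single_neg]

/-- The step of a letter in the torus. -/
def torusStep (N : ℕ) (s : Fin d × Bool) : Fin d → ZMod N := fun j => (letterStep s j : ZMod N)

lemma torusStep_letterRev (s : Fin d × Bool) : torusStep N (letterRev s) = -torusStep N s := by
  ext j
  simp [torusStep, letterStep_letterRev]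

lemma torusStep_true (j : Fin d) : torusStep N (j, true) = Pi.single j 1 := by
  ext i
  by_cases h : i = j <;> simp [torusStep, letterStep, h]

lemma torusStep_false (j : Fin d) : torusStep N (j, false) = -Pi.single j 1 := by
  rw [← torusStep_true, ← torusStep_letterRev]
  rfl

/-- Here `N ≥ 3` matters: modulo `2` the steps `e_j` and `-e_j` coincide. -/
lemma torusStep_injective (hN : 3 ≤ N) : Function.Injective (torusStep (d := d) N) := by
  have : Fact (1 < N) := ⟨by omega⟩
  have : Fact (2 < N) := ⟨by omega⟩
  have h1 : (-1 : ZMod N) ≠ 1 := ZMod.neg_one_ne_one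
  rintro ⟨j, b⟩ ⟨j', b'⟩ h
  have hj := congrFun h j
  obtain rfl : j = j' := by
    by_contra hne
    cases b <;> cases b' <;> simp [torusStep_true, torusStep_false, hne] at hj
  cases b <;> cases b' <;> simp [torusStep_true, torusStep_false, h1, h1.symm] at hj ⊢

lemma torusGraph_adj_iff (hN : 3 ≤ N) (v w : Fin d → ZMod N) :
    (torusGraph d N).Adj v w ↔ ∃ s, w = v + torusStep N s := by
  have : Fact (1 < N) := ⟨by omega⟩
  constructor
  · rintro ⟨-, k, hk, h | h⟩
    · refine ⟨(k, true), funext fun j => ?_⟩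
      by_cases hj : j = k
      · subst hj; simp [torusStep_true, h]
      · simp [torusStep_true, hj, hk j hj]
    · refine ⟨(k, false), funext fun j => ?_⟩
      by_cases hj : j = k
      · subst hj; simp [torusStep_false, h]
      · simp [torusStep_false, hj, hk j hj]
  · rintro ⟨⟨k, b⟩, rfl⟩
    refine ⟨fun h => ?_, k, fun j hj => ?_, ?_⟩
    · have := congrFun h k
      cases b <;> simp [torusStep_true, torusStep_false] at this
    · cases b <;> simp [torusStep_true, torusStep_false, hj]
    · cases b <;> simp [torusStep_true, torusStep_false]

lemma Fin.partialSum_last_eq_sum {M : Type*} [AddCommMonoid M] {k : ℕ} (f : Fin k → M) :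
    Fin.partialSum f (Fin.last k) = ∑ i, f i := by
  simp [Fin.partialSum, List.take_of_length_le, List.sum_ofFn]

lemma sum_torusStep (w : Fin (k + 1) → Fin d × Bool) :
    ∑ i : Fin k, torusStep N (w i.castSucc) = fun j => (displacement w j : ZMod N) := by
  ext j
  simp [torusStep, displacement, Finset.sum_apply]

/-- The walk in the torus from `x` that follows the steps of a word. -/
def torusWalk (x : Fin d → ZMod N) (w : Fin (k + 1) → Fin d × Bool) (i : Fin (k + 1)) :
    Fin d → ZMod N :=
  x + Fin.partialSum (fun j : Fin k => torusStep N (w j.castSucc)) i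

lemma torusWalk_zero (x : Fin d → ZMod N) (w : Fin (k + 1) → Fin d × Bool) :
    torusWalk x w 0 = x := by
  simp [torusWalk]

lemma torusWalk_succ (x : Fin d → ZMod N) (w : Fin (k + 1) → Fin d × Bool) (i : Fin k) :
    torusWalk x w i.succ = torusWalk x w i.castSucc + torusStep N (w i.castSucc) := by
  rw [torusWalk, Fin.partialSum_succ, ← add_assoc, torusWalk]

lemma torusWalk_last (x : Fin d → ZMod N) (w : Fin (k + 1) → Fin d × Bool) :
    torusWalk x w (Fin.last k) = x + fun j => (displacement w j : ZMod N) := by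
  rw [torusWalk, Fin.partialSum_last_eq_sum, sum_torusStep]

lemma torusStep_eq_neg_iff (hN : 3 ≤ N) (s s' : Fin d × Bool) :
    torusStep N s + torusStep N s' = 0 ↔ s' = letterRev s := by
  rw [add_comm, add_eq_zero_iff_eq_neg, ← torusStep_letterRev, (torusStep_injective hN).eq_iff]

/-- Repeating the first letter at the end of the word turns the absence of a tail into the
no-cancellation condition at the last index. -/
lemma torusWalk_isReducedClosedWalk_iff (hN : 3 ≤ N) (x : Fin d → ZMod N)
    (w : Fin (n + 2) → Fin d × Bool) (hw : w (Fin.last (n + 1)) = w 0) :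
    IsReducedClosedWalk (torusGraph d N) x (torusWalk x w) ↔
      w ∈ cyclicWords d (n + 1) ∧ ∀ j, (displacement w j : ZMod N) = 0 := by
  have hlast : torusWalk x w (Fin.last (n + 1)) = x ↔ ∀ j, (displacement w j : ZMod N) = 0 := by
    rw [torusWalk_last, add_eq_left, funext_iff]
    rfl
  have hadj : ∀ i : Fin (n + 1),
      (torusGraph d N).Adj (torusWalk x w i.castSucc) (torusWalk x w i.succ) := fun i =>
    (torusGraph_adj_iff hN _ _).2 ⟨_, torusWalk_succ x w i⟩
  have hback : ∀ i j : Fin (n + 1), (j : ℕ) = i + 1 →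
      (torusWalk x w j.succ = torusWalk x w i.castSucc ↔ w i.succ = letterRev (w i.castSucc)) := by
    intro i j hij
    have hc : j.castSucc = i.succ := Fin.ext (by simp [hij])
    rw [torusWalk_succ, hc, torusWalk_succ, add_assoc, add_eq_left, torusStep_eq_neg_iff hN]
  have htail : torusWalk x w (Fin.last (n + 1)) = x →
      (torusWalk x w (Fin.last n).castSucc = torusWalk x w 1 ↔
        w (Fin.last n).succ = letterRev (w (Fin.last n).castSucc)) := by
    intro hl
    have h1 : torusWalk x w 1 = x + torusStep N (w 0) := by
      have := torusWalk_succ x w 0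
      simpa [torusWalk_zero] using this
    rw [← Fin.succ_last, torusWalk_succ] at hl
    rw [h1, Fin.succ_last, hw, ← torusStep_eq_neg_iff hN]
    constructor
    · intro h
      rw [h, add_assoc, add_eq_left, add_comm] at hl
      exact hl
    · intro h
      rw [← add_zero (torusWalk x w (Fin.last n).castSucc), ← h, ← add_assoc, hl]
  simp only [IsReducedClosedWalk, cyclicWords, Finset.mem_filter, Finset.mem_univ, true_and,
    torusWalk_zero, hw]
  constructor
  · rintro ⟨hl, -, hb, ht⟩
    refine ⟨fun i => ?_, hlast.1 hl⟩
    rcases Fin.eq_castSucc_or_eq_last i with ⟨i, rfl⟩ | rfl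
    · exact fun h => hb i.castSucc i.succ (by simp) ((hback _ _ (by simp)).2 h)
    · exact fun h => ht ((htail hl).2 h)
  · rintro ⟨hr, hd⟩
    refine ⟨hlast.2 hd, hadj, fun i j hij h => hr i ((hback i j hij).1 h), fun h => ?_⟩
    exact hr _ ((htail (hlast.2 hd)).1 h)

/-- A walk from `x` is determined by its steps, and distinct letters give distinct steps. The count
does not depend on `x`, whence the freedom in the base vertex. -/
lemma card_isReducedClosedWalk_torusGraph (hN : 3 ≤ N) (x : Fin d → ZMod N) :
    Nat.card {v : Fin (n + 2) → Fin d → ZMod N // IsReducedClosedWalk (torusGraph d N) x v} =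
      (Finset.filter (fun w => ∀ j, (displacement w j : ZMod N) = 0)
        (cyclicWords d (n + 1))).card := by
  have hmem : ∀ w, w ∈ Finset.filter (fun w => ∀ j, (displacement w j : ZMod N) = 0)
      (cyclicWords d (n + 1)) ↔ w (Fin.last (n + 1)) = w 0 ∧
        IsReducedClosedWalk (torusGraph d N) x (torusWalk x w) := by
    intro w
    rw [Finset.mem_filter]
    constructor
    · intro h
      have hw : w (Fin.last (n + 1)) = w 0 := (Finset.mem_filter.1 h.1).2.1
      exact ⟨hw, (torusWalk_isReducedClosedWalk_iff hN x w hw).2 h⟩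
    · rintro ⟨hw, h⟩
      exact (torusWalk_isReducedClosedWalk_iff hN x w hw).1 h
  let f : {w // w ∈ Finset.filter (fun w => ∀ j, (displacement w j : ZMod N) = 0)
      (cyclicWords d (n + 1))} →
      {v : Fin (n + 2) → Fin d → ZMod N // IsReducedClosedWalk (torusGraph d N) x v} :=
    fun w => ⟨torusWalk x w.1, ((hmem _).1 w.2).2⟩
  have hf : Function.Bijective f := by
    constructor
    · rintro ⟨w, hw⟩ ⟨w', hw'⟩ h
      have h : torusWalk x w = torusWalk x w' := congrArg Subtype.val h
      have hs : ∀ i : Fin (n + 1), w i.castSucc = w' i.castSucc := by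
        intro i
        have hi := torusWalk_succ x w i
        rw [h, torusWalk_succ, add_right_inj] at hi
        exact (torusStep_injective hN hi).symm
      refine Subtype.ext (funext fun i => ?_)
      rcases Fin.eq_castSucc_or_eq_last i with ⟨i, rfl⟩ | rfl
      · exact hs i
      · change w _ = w' _
        rw [((hmem w).1 hw).1, ((hmem w').1 hw').1]
        exact hs 0
    · rintro ⟨v, hv⟩
      choose s hs using fun i => (torusGraph_adj_iff hN _ _).1 (hv.2.2.1 i)
      let w : Fin (n + 2) → Fin d × Bool := Fin.snoc (α := fun _ => Fin d × Bool) s (s 0)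
      have hws : ∀ i : Fin (n + 1), w i.castSucc = s i := fun i => Fin.snoc_castSucc ..
      have hwl : w (Fin.last (n + 1)) = w 0 := by
        rw [← Fin.castSucc_zero, hws]
        exact Fin.snoc_last ..
      have hwv : torusWalk x w = v := by
        funext i
        induction i using Fin.induction with
        | zero => rw [torusWalk_zero, hv.1]
        | succ i ih => rw [torusWalk_succ, ih, hws, ← hs]
      exact ⟨⟨w, (hmem w).2 ⟨hwl, by rwa [hwv]⟩⟩, Subtype.ext hwv⟩
  rw [← Nat.card_congr (Equiv.ofBijective f hf), Nat.card_eq_fintype_card, Fintype.card_coe]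

end TorusWords

/-! ### Fourier analysis of cyclically reduced words -/

/-- The character of `ℤ ^ d` with angles `θ`. -/
noncomputable def latticeChar {d : ℕ} (θ : Fin d → ℝ) (m : Fin d → ℤ) : ℂ :=
  Complex.exp (∑ j, (m j : ℂ) * Complex.I * θ j)

/-- The sum of a character over the cyclically reduced words of length `k`. -/
noncomputable def cyclicWordSum {d : ℕ} (k : ℕ) (θ : Fin d → ℝ) : ℂ :=
  ∑ w ∈ cyclicWords d k, latticeChar θ (displacement w)

section FourierWords

open MeasureTheory

variable {d k : ℕ}

lemma latticeChar_zero (θ : Fin d → ℝ) : latticeChar θ 0 = 1 := by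
  simp [latticeChar]

lemma latticeChar_add (θ : Fin d → ℝ) (m m' : Fin d → ℤ) :
    latticeChar θ (m + m') = latticeChar θ m * latticeChar θ m' := by
  simp only [latticeChar, ← Complex.exp_add, ← Finset.sum_add_distrib]
  congr 1
  exact Finset.sum_congr rfl fun j _ => by simp; ring

lemma latticeChar_sum {ι : Type*} (θ : Fin d → ℝ) (s : Finset ι) (m : ι → Fin d → ℤ) :
    latticeChar θ (∑ i ∈ s, m i) = ∏ i ∈ s, latticeChar θ (m i) := by
  classical
  induction s using Finset.induction_on with
  | empty => simp [latticeChar_zero]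
  | insert a s ha ih => rw [Finset.sum_insert ha, Finset.prod_insert ha, latticeChar_add, ih]

lemma latticeChar_letterStep_mul_rev (θ : Fin d → ℝ) (s : Fin d × Bool) :
    latticeChar θ (letterStep s) * latticeChar θ (letterStep (letterRev s)) = 1 := by
  rw [← latticeChar_add, letterStep_letterRev, add_neg_cancel, latticeChar_zero]

lemma sum_latticeChar_letterStep (θ : Fin d → ℝ) :
    ∑ s : Fin d × Bool, latticeChar θ (letterStep s) = 2 * ∑ j, (Real.cos (θ j) : ℂ) := by
  have h : ∀ (j : Fin d) (a : ℤ), latticeChar θ (Pi.single j a) =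
      Complex.exp (a * Complex.I * θ j) := by
    intro j a
    rw [latticeChar, Finset.sum_eq_single j]
    · simp
    · intro i _ hi; simp [hi]
    · simp
  rw [Fintype.sum_prod_type, Finset.mul_sum]
  refine Finset.sum_congr rfl fun j _ => ?_
  simp only [letterStep, h, Fintype.sum_bool, Complex.ofReal_cos, Complex.two_cos]
  simp [mul_comm]

/-- The closed paths of nonzero weight are the cyclically reduced words. The weight sits on the row
index, so the repeated final letter contributes nothing, in accordance with `displacement`. -/
lemma cyclicWordSum_eq_trace (θ : Fin d → ℝ) : cyclicWordSum k θ =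
    (nonBacktrackingMatrix letterRev (fun s => latticeChar θ (letterStep s)) ^ k).trace := by
  simp only [Matrix.trace, Matrix.diag, matrix_pow_apply_eq_sum_paths]
  rw [Finset.sum_comm, cyclicWordSum, cyclicWords, Finset.sum_filter]
  refine Finset.sum_congr rfl fun w _ => ?_
  rw [Finset.sum_eq_single (w 0) (fun b _ hb => by simp [hb.symm]) (by simp)]
  simp only [true_and]
  by_cases hw : w (Fin.last k) = w 0
  · simp only [hw, true_and, if_true]
    split_ifs with h
    · rw [displacement, latticeChar_sum]
      exact Finset.prod_congr rfl fun i _ => by simp [nonBacktrackingMatrix, h i]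
    · push Not at h
      obtain ⟨i, hi⟩ := h
      exact (Finset.prod_eq_zero (Finset.mem_univ i) (by simp [nonBacktrackingMatrix, hi])).symm
  · simp [hw]

lemma cyclicWordSum_eq_powerSum (θ : Fin d → ℝ) {p p' : ℂ}
    (hsum : p + p' = 2 * ∑ j, (Real.cos (θ j) : ℂ)) (hprod : p * p' = 2 * d - 1) :
    cyclicWordSum k θ = p ^ k + p' ^ k + (d - 1) * (1 + (-1) ^ k) := by
  rw [cyclicWordSum_eq_trace]
  refine trace_nonBacktrackingMatrix_pow letterRev_involutive letterRev_ne
    (latticeChar_letterStep_mul_rev θ) (by simp [mul_comm]) ?_ hprod k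
  rw [hsum, sum_latticeChar_letterStep]

/-- A non-real root has `‖p‖ ^ 2 = q ≤ q ^ 2`. For a real root with `|p| > q` the polynomial would
be at least `(|p| - 1) (|p| - q) > 0`. -/
lemma norm_le_of_quadratic {q l : ℝ} (hq : 1 ≤ q) (hl : |l| ≤ q + 1) {p : ℂ}
    (hp : p ^ 2 - l * p + q = 0) : ‖p‖ ≤ q := by
  obtain ⟨h1, h2⟩ := abs_le.1 hl
  have hre := congrArg Complex.re hp
  have him := congrArg Complex.im hp
  simp only [pow_two, Complex.add_re, Complex.sub_re, Complex.mul_re, Complex.ofReal_re,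
    Complex.ofReal_im, Complex.add_im, Complex.sub_im, Complex.mul_im, Complex.zero_re,
    Complex.zero_im] at hre him
  have key : p.re ^ 2 + p.im ^ 2 ≤ q ^ 2 := by
    rcases eq_or_ne p.im 0 with h | h
    · rw [h] at hre ⊢
      have hle : |p.re| ≤ q := by
        rw [abs_le]
        constructor
        · by_contra! hlt
          nlinarith
        · by_contra! hlt
          nlinarith
      have := sq_le_sq' (abs_le.1 hle).1 (abs_le.1 hle).2
      linarith
    · have hl2 : l = 2 * p.re := by
        have : p.im * (2 * p.re - l) = 0 := by linarith
        rcases mul_eq_zero.1 this with h' | h'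
        · exact absurd h' h
        · linarith
      subst hl2
      nlinarith
  rw [← Real.sqrt_sq (by linarith : 0 ≤ q), Complex.norm_eq_sqrt_sq_add_sq]
  exact Real.sqrt_le_sqrt key

lemma exists_roots (hd : 1 ≤ d) (θ : Fin d → ℝ) :
    ∃ p p' : ℂ, p + p' = 2 * ∑ j, (Real.cos (θ j) : ℂ) ∧ p * p' = 2 * d - 1 ∧
      ‖p‖ ≤ 2 * d - 1 ∧ ‖p'‖ ≤ 2 * d - 1 := by
  set l : ℝ := 2 * ∑ j, Real.cos (θ j) with hl
  have hlc : (l : ℂ) = 2 * ∑ j, (Real.cos (θ j) : ℂ) := by rw [hl]; push_cast; rfl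
  have hd1 : (1 : ℝ) ≤ d := by exact_mod_cast hd
  have habs : |l| ≤ (2 * d - 1 : ℝ) + 1 := by
    have : |∑ j, Real.cos (θ j)| ≤ d := by
      refine (Finset.abs_sum_le_sum_abs _ _).trans ?_
      refine (Finset.sum_le_sum fun j _ => Real.abs_cos_le_one (θ j)).trans ?_
      simp
    rw [hl, abs_mul, abs_two]
    linarith
  obtain ⟨s, hs⟩ := IsAlgClosed.exists_pow_nat_eq ((l : ℂ) ^ 2 - 4 * (2 * d - 1)) two_pos
  have root : ∀ p : ℂ, p ^ 2 - l * p + ((2 * d - 1 : ℝ) : ℂ) = 0 → ‖p‖ ≤ 2 * d - 1 := fun p hp =>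
    norm_le_of_quadratic (by linarith) habs hp
  refine ⟨(l + s) / 2, (l - s) / 2, ?_, ?_, root _ ?_, root _ ?_⟩
  · rw [← hlc]; ring
  · linear_combination -hs / 4
  · push_cast; linear_combination hs / 4
  · push_cast; linear_combination hs / 4

lemma norm_cyclicWordSum_le (hd : 1 ≤ d) (θ : Fin d → ℝ) :
    ‖cyclicWordSum k θ‖ ≤ 2 * d * (2 * d - 1 : ℝ) ^ k := by
  obtain ⟨p, p', hsum, hprod, hp, hp'⟩ := exists_roots hd θ
  have hd1 : (1 : ℝ) ≤ d := by exact_mod_cast hd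
  have hq : (1 : ℝ) ≤ (2 * d - 1 : ℝ) ^ k := one_le_pow₀ (by linarith)
  rw [cyclicWordSum_eq_powerSum θ hsum hprod]
  have h1 : ‖p ^ k‖ ≤ (2 * d - 1 : ℝ) ^ k := by
    rw [norm_pow]; exact pow_le_pow_left₀ (norm_nonneg _) hp k
  have h2 : ‖p' ^ k‖ ≤ (2 * d - 1 : ℝ) ^ k := by
    rw [norm_pow]; exact pow_le_pow_left₀ (norm_nonneg _) hp' k
  have h3 : ‖((d : ℂ) - 1) * (1 + (-1) ^ k)‖ ≤ (d - 1) * 2 := by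
    rw [norm_mul]
    refine mul_le_mul ?_ ?_ (norm_nonneg _) (by linarith)
    · rw [← Complex.ofReal_natCast, ← Complex.ofReal_one, ← Complex.ofReal_sub, Complex.norm_real,
        Real.norm_of_nonneg (by linarith)]
    · refine (norm_add_le _ _).trans ?_
      simp [one_add_one_eq_two]
  refine (norm_add₃_le).trans ?_
  nlinarith

/-- At `θ = 0` all characters equal `1`, so the sum counts the words. -/
lemma card_cyclicWords_le (hd : 1 ≤ d) :
    ((cyclicWords d k).card : ℝ) ≤ 2 * d * (2 * d - 1 : ℝ) ^ k := by
  have h := norm_cyclicWordSum_le (k := k) hd 0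
  have h0 : cyclicWordSum k (0 : Fin d → ℝ) = ((cyclicWords d k).card : ℂ) := by
    simp [cyclicWordSum, latticeChar]
  rwa [h0, Complex.norm_natCast] at h

lemma continuous_latticeChar (m : Fin d → ℤ) : Continuous fun θ => latticeChar θ m := by
  unfold latticeChar
  fun_prop

lemma continuous_cyclicWordSum : Continuous fun θ : Fin d → ℝ => cyclicWordSum k θ :=
  continuous_finsetSum _ fun w _ => continuous_latticeChar (displacement w)

lemma angleCube_subset_pi_Icc : angleCube d ⊆ Set.univ.pi fun _ => Set.Icc 0 (2 * Real.pi) :=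
  Set.pi_mono fun _ _ => Set.Ico_subset_Icc_self

lemma integrableOn_angleCube {f : (Fin d → ℝ) → ℂ} (hf : Continuous f) :
    IntegrableOn f (angleCube d) :=
  (hf.continuousOn.integrableOn_compact
    (isCompact_univ_pi fun _ => isCompact_Icc)).mono_set angleCube_subset_pi_Icc

lemma volume_restrict_angleCube : (volume : Measure (Fin d → ℝ)).restrict (angleCube d) =
    Measure.pi fun _ => volume.restrict (Set.Ico 0 (2 * Real.pi)) := by
  rw [volume_pi, angleCube, Measure.restrict_pi_pi]

lemma integral_exp_int_mul (a : ℤ) :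
    ∫ x in Set.Ico 0 (2 * Real.pi), Complex.exp (a * Complex.I * (x : ℝ)) =
      if a = 0 then 2 * (Real.pi : ℂ) else 0 := by
  rw [integral_Ico_eq_integral_Ioc,
    ← intervalIntegral.integral_of_le (by positivity : (0 : ℝ) ≤ 2 * Real.pi)]
  split_ifs with h
  · subst h
    simp
  · rw [integral_exp_mul_complex (by simp [h])]
    have : Complex.exp (a * Complex.I * ((2 * Real.pi : ℝ) : ℂ)) = 1 :=
      Complex.exp_eq_one_iff.2 ⟨a, by push_cast; ring⟩
    rw [this]
    simp

lemma integral_latticeChar (m : Fin d → ℤ) :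
    ∫ θ in angleCube d, latticeChar θ m = if m = 0 then (2 * (Real.pi : ℂ)) ^ d else 0 := by
  rw [volume_restrict_angleCube]
  simp only [latticeChar, Complex.exp_sum]
  rw [integral_fintype_prod_eq_prod
    (f := fun j (x : ℝ) => Complex.exp ((m j : ℂ) * Complex.I * (x : ℂ)))]
  simp only [integral_exp_int_mul]
  split_ifs with h
  · simp [h]
  · obtain ⟨j, hj⟩ := Function.ne_iff.1 h
    exact Finset.prod_eq_zero (Finset.mem_univ j) (if_neg hj)

lemma integral_cyclicWordSum :
    ∫ θ in angleCube d, cyclicWordSum k θ =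
      ((cyclicWords d k).filter (fun w => displacement w = 0)).card * (2 * (Real.pi : ℂ)) ^ d := by
  simp only [cyclicWordSum]
  rw [integral_finsetSum _ fun w _ => integrableOn_angleCube (continuous_latticeChar _)]
  simp only [integral_latticeChar]
  rw [← Finset.sum_filter, Finset.sum_const, nsmul_eq_mul]

lemma abs_displacement_le (w : Fin (k + 1) → Fin d × Bool) (j : Fin d) :
    |displacement w j| ≤ k := by
  rw [displacement, Finset.sum_apply]
  refine (Finset.abs_sum_le_sum_abs _ _).trans ?_
  have h : ∀ s : Fin d × Bool, |letterStep s j| ≤ 1 := by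
    rintro ⟨i, b⟩
    by_cases hij : j = i
    · subst hij; cases b <;> simp [letterStep]
    · simp [letterStep, hij]
  refine (Finset.sum_le_sum fun i _ => h _).trans ?_
  simp

/-- A word of fewer than `N` letters is too short to wind around the torus. -/
lemma forall_displacement_eq_zero_iff {N : ℕ} (hN : k < N) (w : Fin (k + 1) → Fin d × Bool) :
    (∀ j, (displacement w j : ZMod N) = 0) ↔ displacement w = 0 := by
  constructor
  · intro h
    funext j
    have h1 := (ZMod.intCast_zmod_eq_zero_iff_dvd _ N).1 (h j)
    refine Int.eq_zero_of_abs_lt_dvd h1 ((abs_displacement_le w j).trans_lt ?_)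
    exact_mod_cast hN
  · intro h j
    simp [h]

end FourierWords

/-! ### The limit of the generalized alternating zeta function -/

section LogSeries

variable {z z' : ℂ}

lemma Complex.one_sub_re_pos_of_norm_lt_one (hz : ‖z‖ < 1) : 0 < (1 - z).re := by
  have := Complex.re_le_norm z
  simp only [Complex.sub_re, Complex.one_re]
  linarith

/-- Both arguments lie in `(-π/2, π/2)`. Hence the logarithm of the product splits and the product
avoids the branch cut. -/
lemma Complex.arg_add_arg_mem_Ioo (hz : 0 < z.re) (hz' : 0 < z'.re) :
    z.arg + z'.arg ∈ Set.Ioo (-Real.pi) Real.pi := by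
  have h := abs_lt.1 (Complex.abs_arg_lt_pi_div_two_iff.2 (Or.inl hz))
  have h' := abs_lt.1 (Complex.abs_arg_lt_pi_div_two_iff.2 (Or.inl hz'))
  constructor <;> linarith [h.1, h.2, h'.1, h'.2]

lemma Complex.log_mul_of_re_pos (hz : 0 < z.re) (hz' : 0 < z'.re) :
    Complex.log (z * z') = Complex.log z + Complex.log z' :=
  Complex.log_mul (Complex.ne_zero_of_re_pos hz) (Complex.ne_zero_of_re_pos hz')
    (Set.Ioo_subset_Ioc_self (Complex.arg_add_arg_mem_Ioo hz hz'))

lemma Complex.mul_mem_slitPlane_of_re_pos (hz : 0 < z.re) (hz' : 0 < z'.re) :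
    z * z' ∈ Complex.slitPlane := by
  have hm := Complex.arg_add_arg_mem_Ioo hz hz'
  have h0 := Complex.ne_zero_of_re_pos hz
  have h0' := Complex.ne_zero_of_re_pos hz'
  rw [Complex.mem_slitPlane_iff_arg, Complex.arg_mul h0 h0' (Set.Ioo_subset_Ioc_self hm)]
  exact ⟨hm.2.ne, mul_ne_zero h0 h0'⟩

/-- The even part of the logarithmic series. -/
lemma Complex.hasSum_even_log_series (hz : ‖z‖ < 1) :
    HasSum (fun n : ℕ => (1 + (-1) ^ (n + 1)) / ((n + 1 : ℕ) : ℂ) * z ^ (n + 1))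
      (-Complex.log (1 - z ^ 2)) := by
  -- Adding the series at `z` and at `-z` cancels the odd powers.
  have h := (Complex.hasSum_taylorSeries_neg_log' hz).add
    (Complex.hasSum_taylorSeries_neg_log' (z := -z) (by rwa [norm_neg]))
  have hfac : (1 - z ^ 2) = (1 - z) * (1 - -z) := by ring
  rw [hfac, Complex.log_mul_of_re_pos (Complex.one_sub_re_pos_of_norm_lt_one hz)
    (Complex.one_sub_re_pos_of_norm_lt_one (by rwa [norm_neg])), neg_add]
  refine h.congr_fun ?_
  intro n
  rw [neg_pow z]
  push_cast
  ring

end LogSeries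

section Limit

open MeasureTheory Filter

variable {d : ℕ} {t : ℂ}

lemma norm_root_mul_lt_one (hd : 1 ≤ d) (ht : ‖t‖ < 1 / (2 * (d : ℝ) - 1)) {p : ℂ}
    (hp : ‖p‖ ≤ 2 * d - 1) : ‖p * t‖ < 1 := by
  have hd1 : (1 : ℝ) ≤ d := by exact_mod_cast hd
  rw [lt_div_iff₀ (by linarith)] at ht
  rw [norm_mul]
  nlinarith [norm_nonneg t]

lemma one_sub_sq_re_pos (hz : ‖t‖ < 1) : 0 < (1 - t ^ 2).re := by
  refine Complex.one_sub_re_pos_of_norm_lt_one ?_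
  rw [norm_pow]
  exact pow_lt_one₀ (norm_nonneg t) hz two_ne_zero

/-- This is `(1 - (p t) ^ 2) (1 - (p' t) ^ 2) = (1 + p p' t ^ 2) ^ 2 - (p + p') ^ 2 t ^ 2`. -/
lemma torusLogIntegrand_arg_eq_mul (θ : Fin d → ℝ) {p p' : ℂ}
    (hsum : p + p' = 2 * ∑ j, (Real.cos (θ j) : ℂ)) (hprod : p * p' = 2 * d - 1) :
    (1 + (2 * (d : ℂ) - 1) * t ^ 2) ^ 2 - 4 * t ^ 2 * (∑ j, (Real.cos (θ j) : ℂ)) ^ 2 =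
      (1 - (p * t) ^ 2) * (1 - (p' * t) ^ 2) := by
  have h : (4 : ℂ) * (∑ j, (Real.cos (θ j) : ℂ)) ^ 2 = (p + p') ^ 2 := by rw [hsum]; ring
  rw [← hprod]
  linear_combination (-t ^ 2) * h

lemma torusLogIntegrand_arg_mem_slitPlane (hd : 1 ≤ d) (ht : ‖t‖ < 1 / (2 * (d : ℝ) - 1))
    (θ : Fin d → ℝ) :
    (1 + (2 * (d : ℂ) - 1) * t ^ 2) ^ 2 - 4 * t ^ 2 * (∑ j, (Real.cos (θ j) : ℂ)) ^ 2
      ∈ Complex.slitPlane := by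
  obtain ⟨p, p', hsum, hprod, hp, hp'⟩ := exists_roots hd θ
  rw [torusLogIntegrand_arg_eq_mul θ hsum hprod]
  exact Complex.mul_mem_slitPlane_of_re_pos (one_sub_sq_re_pos (norm_root_mul_lt_one hd ht hp))
    (one_sub_sq_re_pos (norm_root_mul_lt_one hd ht hp'))

lemma continuous_torusLogIntegrand (hd : 1 ≤ d) (ht : ‖t‖ < 1 / (2 * (d : ℝ) - 1)) :
    Continuous (torusLogIntegrand d t) := by
  unfold torusLogIntegrand
  exact Continuous.clog (by fun_prop) (torusLogIntegrand_arg_mem_slitPlane hd ht)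

/-- The coefficient of the number of cyclically reduced words of length `n + 1` in the logarithm
of the zeta function. -/
noncomputable def evenLogCoeff (t : ℂ) (n : ℕ) : ℂ :=
  (1 + (-1) ^ (n + 1)) / ((n + 1 : ℕ) : ℂ) * t ^ (n + 1)

lemma norm_evenLogCoeff_le (n : ℕ) : ‖evenLogCoeff t n‖ ≤ 2 * ‖t‖ ^ (n + 1) := by
  rw [evenLogCoeff, norm_mul, norm_div, norm_pow, Complex.norm_natCast]
  gcongr
  have h1 : ‖(1 : ℂ) + (-1) ^ (n + 1)‖ ≤ 2 := by
    refine (norm_add_le _ _).trans ?_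
    simp [one_add_one_eq_two]
  refine (div_le_self (norm_nonneg _) ?_).trans h1
  simp

lemma hasSum_cyclicWordSum (hd : 1 ≤ d) (ht : ‖t‖ < 1 / (2 * (d : ℝ) - 1)) (θ : Fin d → ℝ) :
    HasSum (fun n => cyclicWordSum (n + 1) θ * evenLogCoeff t n)
      (-(2 * (d - 1) * Complex.log (1 - t ^ 2) + torusLogIntegrand d t θ)) := by
  obtain ⟨p, p', hsum, hprod, hp, hp'⟩ := exists_roots hd θ
  have hd1 : (1 : ℝ) ≤ d := by exact_mod_cast hd
  have hpt := norm_root_mul_lt_one hd ht hp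
  have hpt' := norm_root_mul_lt_one hd ht hp'
  have ht1 : ‖t‖ < 1 := by
    -- The bound for the roots also applies to `1 ≤ 2d - 1`.
    simpa using norm_root_mul_lt_one hd ht (p := 1) (by rw [norm_one]; linarith)
  have h := ((Complex.hasSum_even_log_series hpt).add (Complex.hasSum_even_log_series hpt')).add
    ((Complex.hasSum_even_log_series ht1).mul_left (2 * ((d : ℂ) - 1)))
  have hlog : torusLogIntegrand d t θ =
      Complex.log (1 - (p * t) ^ 2) + Complex.log (1 - (p' * t) ^ 2) := by
    rw [torusLogIntegrand, torusLogIntegrand_arg_eq_mul θ hsum hprod,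
      Complex.log_mul_of_re_pos (one_sub_sq_re_pos hpt) (one_sub_sq_re_pos hpt')]
  convert! h using 1
  · funext n
    rw [cyclicWordSum_eq_powerSum θ hsum hprod, evenLogCoeff]
    -- With `ε = (-1) ^ (n + 1)`, `(1 + ε) ^ 2 = 2 (1 + ε)`: the eigenvalues `1` and `-1` contribute
    -- equally, hence the factor `2 (d - 1)`.
    have hsq : ((-1 : ℂ) ^ (n + 1)) ^ 2 = 1 := by rw [← pow_mul, mul_comm, pow_mul]; simp
    rw [mul_pow, mul_pow]
    linear_combination ((d : ℂ) - 1) / ((n + 1 : ℕ) : ℂ) * t ^ (n + 1) * hsq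
  · rw [hlog]
    ring

lemma summable_bound (hd : 1 ≤ d) (ht : ‖t‖ < 1 / (2 * (d : ℝ) - 1)) :
    Summable fun n : ℕ => 2 * d * (2 * d - 1 : ℝ) ^ (n + 1) * (2 * ‖t‖ ^ (n + 1)) := by
  have hd1 : (1 : ℝ) ≤ d := by exact_mod_cast hd
  have ht' := ht
  rw [lt_div_iff₀ (by linarith)] at ht'
  have h0 : 0 ≤ (2 * d - 1 : ℝ) * ‖t‖ := mul_nonneg (by linarith) (norm_nonneg t)
  have h := (summable_geometric_of_lt_one h0 (by linarith)).mul_left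
    (4 * d * ((2 * d - 1 : ℝ) * ‖t‖))
  refine h.congr fun n => ?_
  rw [mul_pow]
  ring

/-- The factor `1 + (-1) ^ (n + 1)` is `0` or `2`: it encodes both the lack of cycles of odd length
and the two directions in even length. -/
lemma altZetaTerm_torusGraph {N : ℕ} (hN : 3 ≤ N) (x : Fin d → ZMod N) (n : ℕ) :
    altZetaTerm (torusGraph d N) x t n =
      ((cyclicWords d (n + 1)).filter (fun w => ∀ j, (displacement w j : ZMod N) = 0)).card *
        evenLogCoeff t n := by
  rw [altZetaTerm, evenLogCoeff]
  rcases Nat.even_or_odd n with hn | hn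
  · rw [numReducedAltCycles_of_odd_length hn, hn.add_one.neg_one_pow]
    simp
  · rw [numReducedAltCycles_of_even_length hn, card_isReducedClosedWalk_torusGraph hN,
      hn.add_one.neg_one_pow]
    push_cast
    ring

lemma norm_altZetaTerm_torusGraph_le (hd : 1 ≤ d) {N : ℕ} (hN : 3 ≤ N) (x : Fin d → ZMod N)
    (n : ℕ) : ‖altZetaTerm (torusGraph d N) x t n‖ ≤
      2 * d * (2 * d - 1 : ℝ) ^ (n + 1) * (2 * ‖t‖ ^ (n + 1)) := by
  have hd1 : (1 : ℝ) ≤ d := by exact_mod_cast hd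
  rw [altZetaTerm_torusGraph hN, norm_mul, Complex.norm_natCast]
  refine mul_le_mul (le_trans ?_ (card_cyclicWords_le hd)) (norm_evenLogCoeff_le n)
    (norm_nonneg _) ?_
  · exact_mod_cast Finset.card_filter_le _ _
  · have : (0 : ℝ) ≤ (2 * d - 1 : ℝ) ^ (n + 1) := pow_nonneg (by linarith) _
    positivity

lemma tendsto_altZetaTerm_torusGraph (x : ∀ N : ℕ, Fin d → ZMod N) (n : ℕ) :
    Tendsto (fun N => altZetaTerm (torusGraph d N) (x N) t n) atTop
      (nhds (((cyclicWords d (n + 1)).filter (fun w => displacement w = 0)).card *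
        evenLogCoeff t n)) := by
  refine tendsto_const_nhds.congr' ?_
  filter_upwards [eventually_ge_atTop 3, eventually_gt_atTop (n + 1)] with N hN hn
  rw [altZetaTerm_torusGraph hN]
  simp only [forall_displacement_eq_zero_iff hn]

lemma volume_real_angleCube : volume.real (angleCube d) = (2 * Real.pi) ^ d := by
  have h := Real.volume_pi_Ico_toReal (a := fun _ : Fin d => (0 : ℝ)) (b := fun _ => 2 * Real.pi)
    fun _ => by positivity
  simpa [angleCube, Measure.real] using h

lemma two_pi_pow_ne_zero : (2 * (Real.pi : ℂ)) ^ d ≠ 0 :=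
  pow_ne_zero _ (mul_ne_zero two_ne_zero (Complex.ofReal_ne_zero.2 Real.pi_ne_zero))

/-- Integrating `hasSum_cyclicWordSum` term by term and dividing by the volume of the cube leaves in
each term only the words of displacement zero. -/
lemma hasSum_limit (hd : 1 ≤ d) (ht : ‖t‖ < 1 / (2 * (d : ℝ) - 1)) :
    HasSum (fun n => (((cyclicWords d (n + 1)).filter (fun w => displacement w = 0)).card : ℂ) *
        evenLogCoeff t n)
      (-(2 * (d - 1) * Complex.log (1 - t ^ 2) +
        ∫ θ in angleCube d, torusLogIntegrand d t θ / (2 * (Real.pi : ℂ)) ^ d)) := by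
  have : IsFiniteMeasure ((volume : Measure (Fin d → ℝ)).restrict (angleCube d)) := by
    rw [volume_restrict_angleCube]
    infer_instance
  have h := hasSum_integral_of_dominated_convergence
    (μ := (volume : Measure (Fin d → ℝ)).restrict (angleCube d))
    (F := fun n θ => cyclicWordSum (n + 1) θ * evenLogCoeff t n)
    (fun n _ => 2 * d * (2 * d - 1 : ℝ) ^ (n + 1) * (2 * ‖t‖ ^ (n + 1)))
    (fun n => ((continuous_cyclicWordSum (d := d) (k := n + 1)).mul
      (continuous_const (y := evenLogCoeff t n))).aestronglyMeasurable)
    (fun n => Eventually.of_forall fun θ => by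
      rw [norm_mul]
      exact mul_le_mul (norm_cyclicWordSum_le hd θ) (norm_evenLogCoeff_le n) (norm_nonneg _)
        ((norm_nonneg _).trans (norm_cyclicWordSum_le hd θ)))
    (Eventually.of_forall fun _ => summable_bound hd ht)
    (integrable_const _)
    (Eventually.of_forall fun θ => hasSum_cyclicWordSum hd ht θ)
  have h := h.div_const ((2 * (Real.pi : ℂ)) ^ d)
  convert! h using 1
  · funext n
    rw [integral_mul_const, integral_cyclicWordSum]
    field_simp [two_pi_pow_ne_zero (d := d)]
  · rw [integral_neg, integral_add (integrable_const _)
      (integrableOn_angleCube (continuous_torusLogIntegrand hd ht)), integral_const,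
      integral_div, measureReal_restrict_apply_univ, volume_real_angleCube, Complex.real_smul]
    push_cast
    field_simp [two_pi_pow_ne_zero (d := d)]

end Limit

theorem theorem11 (d : ℕ) (hd : 2 ≤ d) (t : ℂ) (ht : ‖t‖ < 1 / (2 * (d : ℝ) - 1))
    (x₀ : ∀ N : ℕ, Fin d → ZMod N) :
    (∀ N : ℕ, 3 ≤ N → Summable (altZetaTerm (torusGraph d N) (x₀ N) t)) ∧
    (∀ θ : Fin d → ℝ,
      (1 + (2 * (d : ℂ) - 1) * t ^ 2) ^ 2 - 4 * t ^ 2 * (∑ j, (Real.cos (θ j) : ℂ)) ^ 2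
        ∈ Complex.slitPlane) ∧
    MeasureTheory.IntegrableOn (torusLogIntegrand d t) (angleCube d) ∧
    Filter.Tendsto (fun N : ℕ => (generalizedAltZeta (torusGraph d N) (x₀ N) t)⁻¹) Filter.atTop
      (nhds ((1 - t ^ 2) ^ (2 * (d - 1)) *
        Complex.exp (∫ θ in angleCube d, torusLogIntegrand d t θ / (2 * (Real.pi : ℂ)) ^ d))) := by
  have hd1 : 1 ≤ d := by omega
  refine ⟨fun N hN => ?_, torusLogIntegrand_arg_mem_slitPlane hd1 ht,
    integrableOn_angleCube (continuous_torusLogIntegrand hd1 ht), ?_⟩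
  · exact Summable.of_norm_bounded (summable_bound hd1 ht)
      (norm_altZetaTerm_torusGraph_le hd1 hN (x₀ N))
  -- Termwise limits suffice because the bound is independent of `N` and of the base vertex.
  have hlim := tendsto_tsum_of_dominated_convergence (summable_bound hd1 ht)
    (tendsto_altZetaTerm_torusGraph (t := t) x₀)
    ((Filter.eventually_ge_atTop 3).mono fun N hN n =>
      norm_altZetaTerm_torusGraph_le hd1 hN (x₀ N) n)
  rw [(hasSum_limit hd1 ht).tsum_eq] at hlim
  have hne : 1 - t ^ 2 ≠ 0 := by
    have hd2 : (1 : ℝ) ≤ d := by exact_mod_cast hd1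
    refine Complex.ne_zero_of_re_pos (one_sub_sq_re_pos ?_)
    simpa using norm_root_mul_lt_one hd1 ht (p := 1) (by rw [norm_one]; linarith)
  have hexp := (Complex.continuous_exp.tendsto _).comp hlim.neg
  -- The multiple of the logarithm is a natural number, so the exponential is an ordinary power; `d
  -- ≥ 1` makes the truncated subtraction exact.
  have hval : (1 - t ^ 2) ^ (2 * (d - 1)) = Complex.exp (2 * (d - 1) * Complex.log (1 - t ^ 2)) := by
    have hcast : (2 * ((d : ℂ) - 1)) = ((2 * (d - 1) : ℕ) : ℂ) := by
      rw [Nat.cast_mul, Nat.cast_sub hd1, Nat.cast_ofNat, Nat.cast_one]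
    rw [hcast, Complex.exp_nat_mul, Complex.exp_log hne]
  rw [hval, ← Complex.exp_add]
  rw [neg_neg] at hexp
  refine hexp.congr fun N => ?_
  rw [generalizedAltZeta, ← Complex.exp_neg]
  rfl
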